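/- Let $\mathbf{p} = 012102101021012101021012\cdots$ be the infinite word over $\{0,1,2\}$ that starts with $0$ and is the fixed point of the morphism $h\colon 0\to 01,\ 1\to 21,\ 2\to 0$. For $n\ge 1$ let $R(n)$ be the recurrence function of $\mathbf{p}$, that is, the smallest positive integer $m$ such that every occurrence of a length-$n$ factor of $\mathbf{p}$ is followed by another occurrence of the same factor at distance at most $m$. Let $X_1=1$, $X_2=2$, $X_3=4$, $X_4=7$ and $X_n=X_{n-1}+X_{n-2}+X_{n-4}$ for $n\ge 5$, and for a binary string $e_t e_{t-1}\cdots e_1$ write $[e_t\cdots e_1]_P=\sum_{1\le k\le t} e_k X_k$. Define the sequences $(B_i)_{i\ge 3}$ and $(C_i)_{i\ge 2}$ by \begin{align*} B_{2i+3} &= [1(01)^i 10]_P, & B_{2i+4} &= [1(01)^i 100]_P,\\ C_{4i+2} &= [10(0010)^i]_P, & C_{4i+3} &= [10(0010)^i 0]_P,\\ C_{4i+4} &= [10(0010)^i 00]_P, & C_{4i+5} &= [10(0010)^i 001]_P \end{align*} for $i\ge 0$. Then $R(n)$ exists for every $n\ge 1$, and $$R(n)=\begin{cases} 5, & n=1;\\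 12, & n=2;\\ 16, & n=3;\\ 21, & n=4;\\ 28, & n=5;\\ X_{i+4}, & B_i\le n\le C_{i+1} \text{ for some } i\ge 3;\\ X_{i+4}+X_{i+2}, & C_{i+1}<n<B_{i+1} \text{ for some } i\ge 3, \end{cases}$$ where, for every $n\ge 6$, exactly one of the last two cases applies, and it does so for exactly one $i\ge 3$. -/

import Mathlib

namespace TernaryWord

/-- The morphism `0 → 01`, `1 → 21`, `2 → 0` on letters. -/
def h : Fin 3 → List (Fin 3)
  | 0 => [0, 1]
  | 1 => [2, 1]
  | 2 => [0]

/-- The finite word obtained from the one-letter word `0` by applying the morphism `k` times. -/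
def hIter : ℕ → List (Fin 3)
  | 0 => [0]
  | k + 1 => (hIter k).flatMap h

theorem hIter_prefix_succ (k : ℕ) : hIter k <+: hIter (k + 1) := by
  induction k with
  | zero => exact ⟨[1], rfl⟩
  | succ k ih =>
    obtain ⟨t, ht⟩ := ih
    refine ⟨t.flatMap h, ?_⟩
    change (hIter k).flatMap h ++ t.flatMap h = (hIter (k + 1)).flatMap h
    rw [← List.flatMap_append, ht]

theorem length_le_length_flatMap (w : List (Fin 3)) : w.length ≤ (w.flatMap h).length := by
  induction w with
  | nil => simp
  | cons a w ih =>
    have ha : 1 ≤ (h a).length := by fin_cases a <;> decide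
    simp only [List.flatMap_cons, List.length_append, List.length_cons]
    omega

theorem lt_length_hIter (k : ℕ) : k < (hIter k).length := by
  -- every iterate starts with the letter `0`, whose image has two letters
  suffices H : ∃ t, hIter k = 0 :: t ∧ k + 1 ≤ (hIter k).length by
    obtain ⟨_, _, H⟩ := H
    exact H
  induction k with
  | zero => exact ⟨[], rfl, le_rfl⟩
  | succ k ih =>
    obtain ⟨t, ht, hl⟩ := ih
    refine ⟨1 :: t.flatMap h, ?_, ?_⟩
    · change (hIter k).flatMap h = _
      rw [ht]; rfl
    · change _ ≤ ((hIter k).flatMap h).length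
      rw [ht] at hl ⊢
      have := length_le_length_flatMap t
      simp only [List.flatMap_cons, List.length_append, List.length_cons] at hl ⊢
      have h0 : (h 0).length = 2 := rfl
      omega

/-- The infinite word `p = 0121021010210...`, the fixed point of `h` that starts with `0`
(positions are counted from `0`): the limit of the words `h^k(0)`, each of which is a prefix of
the next. -/
def p (n : ℕ) : Fin 3 := (hIter n)[n]'(lt_length_hIter n)

/-- Every `h^k(0)` is a prefix of `p`. -/
theorem hIter_getElem (k n : ℕ) (hn : n < (hIter k).length) : (hIter k)[n] = p n := by
  have mono : ∀ a d, hIter a <+: hIter (a + d) := by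
    intro a d
    induction d with
    | zero => exact List.prefix_refl _
    | succ d ih => exact ih.trans (hIter_prefix_succ (a + d))
  rcases le_total k n with hkn | hkn
  · obtain ⟨d, rfl⟩ := Nat.exists_eq_add_of_le hkn
    exact (mono k d).getElem hn
  · obtain ⟨d, rfl⟩ := Nat.exists_eq_add_of_le hkn
    exact ((mono n d).getElem (lt_length_hIter n)).symm

/-- The linear recurrence `X₁ = 1, X₂ = 2, X₃ = 4, X₄ = 7`, `Xₙ = Xₙ₋₁ + Xₙ₋₂ + Xₙ₋₄` for `n ≥ 5`.
The value at `0` is never used. -/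
def X : ℕ → ℕ
  | 0 => 1
  | 1 => 1
  | 2 => 2
  | 3 => 4
  | 4 => 7
  | n + 5 => X (n + 4) + X (n + 3) + X (n + 1)

/-- `val [e_t, ..., e_1] = ∑ e_i X_i`: the number `[e_t ⋯ e_1]_P` represented by a digit string,
most significant digit first. -/
def val : List ℕ → ℕ
  | [] => 0
  | e :: w => e * X (w.length + 1) + val w

/-- The concatenation of `i` copies of the string `w`. -/
def rep (i : ℕ) (w : List ℕ) : List ℕ := (List.replicate i w).flatten

/-- The sequence `B`, meaningful for indices `≥ 3`. -/
def B (j : ℕ) : ℕ :=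
  if j % 2 = 1 then val ([1] ++ rep ((j - 3) / 2) [0, 1] ++ [1, 0])
  else val ([1] ++ rep ((j - 4) / 2) [0, 1] ++ [1, 0, 0])

theorem B_odd (i : ℕ) : B (2 * i + 3) = val ([1] ++ rep i [0, 1] ++ [1, 0]) := by
  have h1 : (2 * i + 3) % 2 = 1 := by omega
  have h2 : (2 * i + 3 - 3) / 2 = i := by omega
  simp only [B, h1, h2, if_true]

theorem B_even (i : ℕ) : B (2 * i + 4) = val ([1] ++ rep i [0, 1] ++ [1, 0, 0]) := by
  have h1 : ¬ (2 * i + 4) % 2 = 1 := by omega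
  have h2 : (2 * i + 4 - 4) / 2 = i := by omega
  simp only [B, h1, h2, if_false]

/-- The last block of digits in the definition of `C`, according to the residue of the index
minus `2` modulo `4`. -/
def cTail : ℕ → List ℕ
  | 0 => []
  | 1 => [0]
  | 2 => [0, 0]
  | _ => [0, 0, 1]

/-- The sequence `C`, meaningful for indices `≥ 2`. -/
def C (j : ℕ) : ℕ :=
  val ([1, 0] ++ rep ((j - 2) / 4) [0, 0, 1, 0] ++ cTail ((j - 2) % 4))

theorem C_two (i : ℕ) : C (4 * i + 2) = val ([1, 0] ++ rep i [0, 0, 1, 0]) := by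
  have h1 : (4 * i + 2 - 2) / 4 = i := by omega
  have h2 : (4 * i + 2 - 2) % 4 = 0 := by omega
  simp only [C, h1, h2, cTail, List.append_nil]

theorem C_three (i : ℕ) : C (4 * i + 3) = val ([1, 0] ++ rep i [0, 0, 1, 0] ++ [0]) := by
  have h1 : (4 * i + 3 - 2) / 4 = i := by omega
  have h2 : (4 * i + 3 - 2) % 4 = 1 := by omega
  simp only [C, h1, h2, cTail]

theorem C_four (i : ℕ) : C (4 * i + 4) = val ([1, 0] ++ rep i [0, 0, 1, 0] ++ [0, 0]) := by
  have h1 : (4 * i + 4 - 2) / 4 = i := by omega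
  have h2 : (4 * i + 4 - 2) % 4 = 2 := by omega
  simp only [C, h1, h2, cTail]

theorem C_five (i : ℕ) : C (4 * i + 5) = val ([1, 0] ++ rep i [0, 0, 1, 0] ++ [0, 0, 1]) := by
  have h1 : (4 * i + 5 - 2) / 4 = i := by omega
  have h2 : (4 * i + 5 - 2) % 4 = 3 := by omega
  simp only [C, h1, h2, cTail]

/-- Every occurrence (at a position `i`) of a length-`n` factor of the infinite word `x` is followed
by another occurrence of the same factor (at a position `j`) at distance at most `m`. -/
def RecursWithin {α : Type*} (x : ℕ → α) (n m : ℕ) : Prop :=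
  ∀ i, ∃ j, i < j ∧ j ≤ i + m ∧ ∀ k < n, x (j + k) = x (i + k)

/-- The recurrence function of `x`: the smallest positive `m` with `RecursWithin x n m`. -/
noncomputable def R {α : Type*} (x : ℕ → α) (n : ℕ) : ℕ :=
  sInf {m | 0 < m ∧ RecursWithin x n m}

end TernaryWord

/-! The function R is controlled by the bispecial factors. If `w` is a factor, `h w` can be extended
by the letters that `h` forces: a `1` in front if `w` starts with `2`, a `0` behind if `w` ends with
`1`. The resulting map `F` generates the family `bisp` from `1` and `10`. It is compatible with
occurrences through the strictly increasing map `ψ`, and the letter counts between two occurrences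
of the same word change by the incidence matrix of `h`.

Upper bound: an infinite word is covered by overlapping words running from one occurrence of `bisp
k` to a later one, and every factor of length `|bisp k| + 1` lies inside such a word. If these words
all recur within a given letter count, so do their images (`Chain.map`); finite checks for `1` and
`10` start the induction and give the bound `g (k + 5)`. Lower bound: a suitable two-sided extension
of `bisp k` has two consecutive occurrences at distance exactly `g (k + 6)`. This propagates because
extensions of `F w` can be desubstituted (`Gap.map`). Hence `R n = g (k + 6)` for `|bisp k| + 2 ≤ n
≤ |bisp (k + 1)| + 1` (`R_eq_g`). Linear recurrences then identify these lengths with `B` and `C`,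
the odd-indexed values of `g` with `X`, and the even-indexed ones with sums of two terms of `X`. -/

namespace TernaryWord

/-! ### Occurrences of finite words -/

/-- The finite word `w` occurs in `p` at position `s`. -/
def Occ : List (Fin 3) → ℕ → Prop
  | [], _ => True
  | a :: w, s => p s = a ∧ Occ w (s + 1)

theorem occ_append (u v : List (Fin 3)) (s : ℕ) :
    Occ (u ++ v) s ↔ Occ u s ∧ Occ v (s + u.length) := by
  induction u generalizing s with
  | nil => simp [Occ]
  | cons a u ih =>
    simp only [List.cons_append, Occ, ih, List.length_cons, and_assoc]
    rw [show s + 1 + u.length = s + (u.length + 1) by omega]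

theorem occ_iff (w : List (Fin 3)) (s : ℕ) :
    Occ w s ↔ ∀ k (hk : k < w.length), w[k] = p (s + k) := by
  induction w generalizing s with
  | nil => simp [Occ]
  | cons a w ih =>
    simp only [Occ, ih]
    constructor
    · rintro ⟨h0, h1⟩ k hk
      cases k with
      | zero => simp [h0]
      | succ k =>
        have := h1 k (by simpa using hk)
        simpa [show s + 1 + k = s + (k + 1) by omega] using this
    · intro H
      refine ⟨(H 0 (by simp)).symm, fun k hk => ?_⟩
      have := H (k + 1) (by simpa using hk)
      simpa [show s + 1 + k = s + (k + 1) by omega] using this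

theorem Occ.agree {w : List (Fin 3)} {s s' : ℕ} (h1 : Occ w s) (h2 : Occ w s') :
    ∀ k < w.length, p (s' + k) = p (s + k) := fun k hk => by
  rw [← (occ_iff w s).1 h1 k hk, ← (occ_iff w s').1 h2 k hk]

theorem Occ.of_agree {w : List (Fin 3)} {s s' : ℕ} (h1 : Occ w s)
    (h2 : ∀ k < w.length, p (s' + k) = p (s + k)) : Occ w s' :=
  (occ_iff w s').2 fun k hk => by rw [h2 k hk, (occ_iff w s).1 h1 k hk]

/-! ### Cutting `p` into the blocks `h (p t)` -/

/-- `H t` is the length of the image under `h` of the prefix of `p` of length `t`. -/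
def H : ℕ → ℕ
  | 0 => 0
  | t + 1 => H t + (h (p t)).length

theorem occ_hIter (k : ℕ) : Occ (hIter k) 0 :=
  (occ_iff _ _).2 fun n hn => by rw [hIter_getElem, Nat.zero_add]

theorem length_flatMap_take (k t : ℕ) (ht : t ≤ (hIter k).length) :
    (((hIter k).take t).flatMap h).length = H t := by
  induction t with
  | zero => simp [H]
  | succ t ih =>
    rw [List.take_succ_eq_append_getElem (by omega), List.flatMap_append, List.length_append,
      ih (by omega), hIter_getElem, H]
    simp

theorem occ_H (t : ℕ) : Occ (h (p t)) (H t) := by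
  have hl := lt_length_hIter t
  have e : hIter (t + 1) = ((hIter t).take t).flatMap h ++
      (h (p t) ++ ((hIter t).drop (t + 1)).flatMap h) := by
    conv_lhs => rw [hIter, ← List.take_append_drop t (hIter t),
      List.drop_eq_getElem_cons hl, hIter_getElem]
    simp
  have := occ_hIter (t + 1)
  rw [e, occ_append, occ_append, length_flatMap_take t t hl.le, Nat.zero_add] at this
  exact this.2.1

theorem occ_map {w : List (Fin 3)} {s : ℕ} (hw : Occ w s) :
    Occ (w.flatMap h) (H s) ∧ H (s + w.length) = H s + (w.flatMap h).length := by
  induction w generalizing s with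
  | nil => simp [Occ]
  | cons a w ih =>
    obtain ⟨ha, hw⟩ := hw
    obtain ⟨h1, h2⟩ := ih hw
    rw [List.flatMap_cons, occ_append, List.length_append, List.length_cons]
    have e : H (s + 1) = H s + (h a).length := by rw [H, ha]
    refine ⟨⟨ha ▸ occ_H s, e ▸ h1⟩, ?_⟩
    rw [show s + (w.length + 1) = s + 1 + w.length by omega, h2, e]
    omega

theorem fin3 (a : Fin 3) : a = 0 ∨ a = 1 ∨ a = 2 := by
  fin_cases a <;> simp

theorem block0 {t : ℕ} (ht : p t = 0) : H (t + 1) = H t + 2 ∧ p (H t) = 0 ∧ p (H t + 1) = 1 := by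
  have := occ_H t
  rw [ht] at this
  refine ⟨by simp [H, ht, h], this.1, this.2.1⟩

theorem block1 {t : ℕ} (ht : p t = 1) : H (t + 1) = H t + 2 ∧ p (H t) = 2 ∧ p (H t + 1) = 1 := by
  have := occ_H t
  rw [ht] at this
  refine ⟨by simp [H, ht, h], this.1, this.2.1⟩

theorem block2 {t : ℕ} (ht : p t = 2) : H (t + 1) = H t + 1 ∧ p (H t) = 0 := by
  have := occ_H t
  rw [ht] at this
  refine ⟨by simp [H, ht, h], this.1⟩

theorem H_step (t : ℕ) : H t + 1 ≤ H (t + 1) ∧ H (t + 1) ≤ H t + 2 := by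
  rcases fin3 (p t) with ht | ht | ht
  · have := (block0 ht).1; omega
  · have := (block1 ht).1; omega
  · have := (block2 ht).1; omega

theorem H_strictMono : StrictMono H :=
  strictMono_nat_of_lt_succ fun t => (H_step t).1

theorem p_H_ne_one (t : ℕ) : p (H t) ≠ 1 := by
  rcases fin3 (p t) with ht | ht | ht
  · simp [(block0 ht).2.1]
  · simp [(block1 ht).2.1]
  · simp [(block2 ht).2]

theorem exists_block (n : ℕ) : ∃ t, n = H t ∨ (n = H t + 1 ∧ H (t + 1) = H t + 2 ∧ p n = 1) := by
  induction n with
  | zero => exact ⟨0, Or.inl rfl⟩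
  | succ n ih =>
    obtain ⟨t, rfl | ⟨h1, h2, h3⟩⟩ := ih
    · rcases fin3 (p t) with ht | ht | ht
      · exact ⟨t, Or.inr ⟨rfl, (block0 ht).1, (block0 ht).2.2⟩⟩
      · exact ⟨t, Or.inr ⟨rfl, (block1 ht).1, (block1 ht).2.2⟩⟩
      · exact ⟨t + 1, Or.inl (block2 ht).1.symm⟩
    · exact ⟨t + 1, Or.inl (by omega)⟩

/-- The letter `1` occurs only as the second letter of a block. With `p_H_ne_one`, the cutting
points are thus exactly the positions not carrying `1`, so they can be read off locally. -/
theorem exists_eq_H {n : ℕ} (hn : p n ≠ 1) : ∃ t, n = H t := by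
  obtain ⟨t, ht | ht⟩ := exists_block n
  · exact ⟨t, ht⟩
  · exact absurd ht.2.2 hn

theorem next_of_two {n : ℕ} (hn : p n = 2) : p (n + 1) = 1 := by
  obtain ⟨t, rfl⟩ := exists_eq_H (n := n) (by simp [hn])
  rcases fin3 (p t) with ht | ht | ht
  · simp [(block0 ht).2.1] at hn
  · exact (block1 ht).2.2
  · simp [(block2 ht).2] at hn

theorem next_of_one {n : ℕ} (hn : p n = 1) : p (n + 1) ≠ 1 := by
  obtain ⟨t, rfl | ⟨rfl, h2, -⟩⟩ := exists_block n
  · exact absurd hn (p_H_ne_one t)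
  · rw [show H t + 1 + 1 = H (t + 1) by omega]
    exact p_H_ne_one _

theorem next_of_zero {n : ℕ} (hn : p n = 0) : p (n + 1) ≠ 0 := by
  obtain ⟨t, rfl⟩ := exists_eq_H (n := n) (by simp [hn])
  rcases fin3 (p t) with ht | ht | ht
  · simp [(block0 ht).2.2]
  · simp [(block1 ht).2.1] at hn
  · rw [← (block2 ht).1, (block1 (next_of_two ht)).2.1]
    decide

/-! ### Letter counts and the incidence matrix -/

/-- The number of occurrences of the letter `x` among the first `t` letters of `p`. -/
def Z (x : Fin 3) : ℕ → ℕ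
  | 0 => 0
  | t + 1 => Z x t + if p t = x then 1 else 0

theorem Z_sum (t : ℕ) : Z 0 t + Z 1 t + Z 2 t = t := by
  induction t with
  | zero => rfl
  | succ t ih =>
    rcases fin3 (p t) with ht | ht | ht <;> simp [Z, ht] <;> omega

theorem Z_H (t : ℕ) :
    Z 0 (H t) = Z 0 t + Z 2 t ∧ Z 1 (H t) = Z 0 t + Z 1 t ∧ Z 2 (H t) = Z 1 t := by
  induction t with
  | zero => exact ⟨rfl, rfl, rfl⟩
  | succ t ih =>
    obtain ⟨i0, i1, i2⟩ := ih
    rcases fin3 (p t) with ht | ht | ht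
    · obtain ⟨e, e0, e1⟩ := block0 ht
      rw [e]; simp [Z, ht, e0, e1]; omega
    · obtain ⟨e, e0, e1⟩ := block1 ht
      rw [e]; simp [Z, ht, e0, e1]; omega
    · obtain ⟨e, e0⟩ := block2 ht
      rw [e]; simp [Z, ht, e0]; omega

theorem Z_add_length {w : List (Fin 3)} {s : ℕ} (hw : Occ w s) (x : Fin 3) :
    Z x (s + w.length) = Z x s + w.count x := by
  induction w generalizing s with
  | nil => simp
  | cons a w ih =>
    rw [List.length_cons, show s + (w.length + 1) = s + 1 + w.length by omega, ih hw.2, Z, hw.1,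
      List.count_cons]
    simp; omega

/-! ### Images with forced borders -/

/-- The word forced around the image of `w` in `p`. -/
def F (w : List (Fin 3)) : List (Fin 3) :=
  (if w.head? = some 2 then [1] else []) ++ w.flatMap h ++
    (if w.getLast? = some 1 then [0] else [])

/-- The position of the word forced around the image of a word occurring at `s`. -/
def ψ (s : ℕ) : ℕ := H s - if p s = 2 then 1 else 0

theorem before_two {s : ℕ} (hs : p s = 2) : ∃ u, s = u + 1 ∧ p u ≠ 2 ∧ H s = H u + 2 ∧
    p (H u + 1) = 1 := by
  cases s with
  | zero => exact absurd hs (by decide)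
  | succ u =>
    rcases fin3 (p u) with ht | ht | ht
    · exact ⟨u, rfl, by simp [ht], (block0 ht).1, (block0 ht).2.2⟩
    · exact ⟨u, rfl, by simp [ht], (block1 ht).1, (block1 ht).2.2⟩
    · simp [next_of_two ht] at hs

theorem ψ_add (s : ℕ) : ψ s + (if p s = 2 then 1 else 0) = H s := by
  unfold ψ
  split_ifs with hs
  · obtain ⟨u, -, -, h1, -⟩ := before_two hs
    omega
  · omega

/-- The correction to `Z_H` depends on `p s` alone, so it cancels between two occurrences of the
same word. -/
theorem Z_ψ (s : ℕ) : Z 0 (ψ s) = Z 0 s + Z 2 s ∧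
    Z 1 (ψ s) + (if p s = 2 then 1 else 0) = Z 0 s + Z 1 s ∧ Z 2 (ψ s) = Z 1 s := by
  have hZ := Z_H s
  by_cases hs : p s = 2
  · obtain ⟨u, rfl, -, h1, h2⟩ := before_two hs
    have e : ψ (u + 1) = H u + 1 := by simp [ψ, hs, h1]
    rw [h1] at hZ
    simp [Z, h2] at hZ
    rw [e]; simp [Z, hs]; omega
  · simp [ψ, hs, hZ]

/-- A `2` is preceded by `0` or `1`, whose images both end in `1`; a `1` is followed by `0` or `2`,
whose images both start with `0`. -/
theorem occ_F {w : List (Fin 3)} {s : ℕ} (hw : Occ w s) (hne : w ≠ []) : Occ (F w) (ψ s) := by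
  obtain ⟨h1, h2⟩ := occ_map hw
  have hd : w.head? = some (p s) := by
    cases w with
    | nil => exact absurd rfl hne
    | cons a w => simp [hw.1]
  rw [F, List.append_assoc, occ_append, occ_append]
  have hA : Occ (if w.head? = some 2 then [1] else []) (ψ s) := by
    rw [hd]
    by_cases hs : p s = 2
    · obtain ⟨u, rfl, -, h1, h2⟩ := before_two hs
      simp [hs, ψ, h1, Occ, h2]
    · simp [hs, Occ]
  have hl : ψ s + (if w.head? = some 2 then [(1 : Fin 3)] else []).length = H s := by
    rw [← ψ_add s, hd]
    by_cases hs : p s = 2 <;> simp [hs]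
  refine ⟨hA, by rwa [hl], ?_⟩
  rw [hl, ← h2]
  split_ifs with hL
  · rw [List.getLast?_eq_some_iff] at hL
    obtain ⟨v, rfl⟩ := hL
    rw [occ_append] at hw
    have h3 := next_of_one hw.2.1
    rw [List.length_append, List.length_singleton, ← Nat.add_assoc]
    refine ⟨?_, trivial⟩
    rcases fin3 (p (s + v.length + 1)) with ht | ht | ht
    · exact (block0 ht).2.1
    · exact absurd ht h3
    · exact (block2 ht).2
  · trivial

theorem ψ_strictMono : StrictMono ψ :=
  strictMono_nat_of_lt_succ fun s => by
    have h1 := ψ_add s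
    have h2 := ψ_add (s + 1)
    have h3 := (H_step s).1
    by_cases hs : p (s + 1) = 2
    · obtain ⟨u, hu, -, h4, -⟩ := before_two hs
      obtain rfl : s = u := by omega
      rw [if_pos hs] at h2
      omega
    · rw [if_neg hs] at h2
      omega

theorem Occ.head?_eq {w : List (Fin 3)} {s : ℕ} (hw : Occ w s) (hne : w ≠ []) :
    w.head? = some (p s) := by
  cases w with
  | nil => exact absurd rfl hne
  | cons a w => simp [hw.1]

theorem Occ.exists_last {w : List (Fin 3)} {s : ℕ} (hw : Occ w s) (hne : w ≠ []) :
    ∃ m, s + w.length = m + 1 ∧ s ≤ m ∧ w.getLast? = some (p m) := by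
  rcases List.eq_nil_or_concat w with rfl | ⟨v, a, rfl⟩
  · exact absurd rfl hne
  · rw [List.concat_eq_append, occ_append] at hw
    exact ⟨s + v.length, by simp; omega, by omega, by simp [hw.2.1]⟩

/-- The end of the forced word around the image of a word whose last position is `m`. -/
theorem ψ_add_length {w : List (Fin 3)} {s m : ℕ} (hw : Occ w s) (hne : w ≠ [])
    (hm : s + w.length = m + 1) (hL : w.getLast? = some (p m)) :
    ψ s + (F w).length = H (m + 1) + if p m = 1 then 1 else 0 := by
  have h1 := ψ_add s
  have h2 := (occ_map hw).2
  rw [hm] at h2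
  simp only [F, hw.head?_eq hne, hL, List.length_append, Option.some.injEq]
  rw [h2, ← h1]
  split_ifs <;> simp <;> omega

theorem end_le_end {u w : List (Fin 3)} {q s : ℕ} (hu : Occ u q) (hw : Occ w s) (hune : u ≠ [])
    (hwne : w ≠ []) (hle : q + u.length ≤ s + w.length) :
    ψ q + (F u).length ≤ ψ s + (F w).length := by
  obtain ⟨m, hm, -, hL⟩ := hu.exists_last hune
  obtain ⟨m', hm', -, hL'⟩ := hw.exists_last hwne
  rw [ψ_add_length hu hune hm hL, ψ_add_length hw hwne hm' hL']
  rcases eq_or_lt_of_le (show m ≤ m' by omega) with rfl | hlt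
  · exact le_rfl
  · have := H_strictMono (show m + 1 < m' + 1 by omega)
    split_ifs <;> omega

theorem length_F_ge (w : List (Fin 3)) : w.length ≤ (F w).length := by
  have := length_le_length_flatMap w
  simp only [F, List.length_append]
  omega

theorem F_ne_nil {w : List (Fin 3)} (hw : w ≠ []) : F w ≠ [] := by
  have h1 := length_F_ge w
  have h2 := List.length_pos_iff.2 hw
  exact List.length_pos_iff.1 (by omega)

/-! ### Upper bounds: chains of recurring words -/

/-- A family of occurrences `(s, w)` running through `p` from some point on, such that successive
members share an occurrence of `u`, and such that each recurs after a word with at most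
`n₀, n₁, n₂` letters `0, 1, 2`. -/
def Chain (u : List (Fin 3)) (n₀ n₁ n₂ : ℕ) : Prop :=
  ∃ S : ℕ → List (Fin 3) → Prop, (∃ s w, S s w) ∧ ∀ s w, S s w → w ≠ [] ∧ Occ w s ∧
    (∃ s' w' q, S s' w' ∧ s < s' ∧ s' ≤ q ∧ Occ u q ∧ q + u.length ≤ s + w.length) ∧
    (∃ s', s < s' ∧ Occ w s' ∧ Z 0 s' ≤ Z 0 s + n₀ ∧ Z 1 s' ≤ Z 1 s + n₁ ∧ Z 2 s' ≤ Z 2 s + n₂)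

theorem Chain.map {u : List (Fin 3)} {n₀ n₁ n₂ : ℕ} (hu : u ≠ []) (hc : Chain u n₀ n₁ n₂) :
    Chain (F u) (n₀ + n₂) (n₀ + n₁) n₁ := by
  obtain ⟨S, ⟨s, w, hs⟩, hS⟩ := hc
  refine ⟨fun σ ω => ∃ s w, S s w ∧ σ = ψ s ∧ ω = F w, ⟨ψ s, F w, s, w, hs, rfl, rfl⟩, ?_⟩
  rintro _ _ ⟨s, w, hs, rfl, rfl⟩
  obtain ⟨hne, hw, ⟨s', w', q, h1, h2, h3, h4, h5⟩, r, hr1, hr2, hr3, hr4, hr5⟩ := hS s w hs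
  refine ⟨F_ne_nil hne, occ_F hw hne, ⟨ψ s', F w', ψ q, ⟨s', w', h1, rfl, rfl⟩, ψ_strictMono h2,
    ψ_strictMono.monotone h3, occ_F h4 hu, end_le_end h4 hw hu hne h5⟩,
    ψ r, ψ_strictMono hr1, occ_F hr2 hne, ?_⟩
  have e : p r = p s := by
    have := hw.head?_eq hne
    rw [hr2.head?_eq hne] at this
    simpa using this
  have z1 := Z_ψ s
  have z2 := Z_ψ r
  rw [e] at z2
  omega

/-- Successive members overlap in at least `|u|` letters, so a window of length `|u| + 1` cannot
straddle the end of one member without starting inside the next; it recurs with the member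
containing it. -/
theorem Chain.exists_recur {u : List (Fin 3)} {n₀ n₁ n₂ : ℕ} (hc : Chain u n₀ n₁ n₂) :
    ∃ T, ∀ t, T ≤ t → ∃ j, t < j ∧ j ≤ t + (n₀ + n₁ + n₂) ∧
      ∀ k < u.length + 1, p (j + k) = p (t + k) := by
  obtain ⟨S, ⟨s₀, w₀, hs₀⟩, hS⟩ := hc
  refine ⟨s₀, fun t ht => ?_⟩
  -- Walk along the chain; each member starts strictly later, so `t - s` decreases.
  have key : ∀ d s w, S s w → s ≤ t → t - s ≤ d →
      ∃ s w, S s w ∧ s ≤ t ∧ t + u.length + 1 ≤ s + w.length := by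
    intro d
    induction d with
    | zero =>
      intro s w hs h1 h2
      obtain ⟨-, -, ⟨s', w', q, h3, h4, h5, -, h6⟩, -⟩ := hS s w hs
      exact ⟨s, w, hs, h1, by omega⟩
    | succ d ih =>
      intro s w hs h1 h2
      by_cases hend : t + u.length + 1 ≤ s + w.length
      · exact ⟨s, w, hs, h1, hend⟩
      · obtain ⟨-, -, ⟨s', w', q, h3, h4, h5, -, h6⟩, -⟩ := hS s w hs
        exact ih s' w' h3 (by omega) (by omega)
  obtain ⟨s, w, hs, h1, h2⟩ := key _ s₀ w₀ hs₀ ht le_rfl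
  obtain ⟨-, hw, -, r, hr1, hr2, hr3, hr4, hr5⟩ := hS s w hs
  have z1 := Z_sum s
  have z2 := Z_sum r
  refine ⟨r + (t - s), by omega, by omega, fun k hk => ?_⟩
  have := hw.agree hr2 (t - s + k) (by omega)
  rwa [show r + (t - s + k) = r + (t - s) + k by omega, show s + (t - s + k) = t + k by omega]
    at this

theorem iterate_H (k i : ℕ) (hi : p i = 0) : Occ (hIter k) (H^[k] i) := by
  induction k with
  | zero => exact ⟨hi, trivial⟩
  | succ k ih =>
    rw [Function.iterate_succ_apply']
    exact (occ_map ih).1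

theorem exists_zero_ge (M : ℕ) : ∃ i, M ≤ i ∧ p i = 0 := by
  suffices ∃ i, M + 1 ≤ i ∧ p i = 0 by
    obtain ⟨i, h1, h2⟩ := this
    exact ⟨i, by omega, h2⟩
  induction M with
  | zero => exact ⟨4, by omega, by decide⟩
  | succ M ih =>
    obtain ⟨i, h1, h2⟩ := ih
    refine ⟨H i, ?_, (block0 h2).2.1⟩
    have h3 : ∀ i, 1 ≤ i → i < H i := by
      intro i hi
      induction i, hi using Nat.le_induction with
      | base => decide
      | succ i _ ih =>
        have := (H_step i).1
        omega
    have := h3 i (by omega)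
    omega

/-- Each far-away letter `0` has an image under the `N`-th iterate of `h` that is a prefix of `p`
longer than `N`. -/
theorem prefix_recurs (N M : ℕ) : ∃ T, M ≤ T ∧ ∀ k < N, p (T + k) = p k := by
  obtain ⟨i, h1, h2⟩ := exists_zero_ge M
  refine ⟨H^[N] i, h1.trans ?_, fun k hk => ?_⟩
  · have : ∀ n, i ≤ H^[n] i := by
      intro n
      induction n with
      | zero => exact le_rfl
      | succ n ih =>
        rw [Function.iterate_succ_apply']
        exact ih.trans (H_strictMono.le_apply)
    exact this N
  · simpa using (occ_hIter N).agree (iterate_H N i h2) k (hk.trans (lt_length_hIter N))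

/-- Any finite stretch of `p` is copied beyond `T`, so a chain need not start at position `0`. -/
theorem recursWithin_of_eventually {n m T : ℕ}
    (hT : ∀ t, T ≤ t → ∃ j, t < j ∧ j ≤ t + m ∧ ∀ k < n, p (j + k) = p (t + k)) :
    RecursWithin p n m := by
  intro i
  obtain ⟨U, hU, hag⟩ := prefix_recurs (i + m + n) T
  obtain ⟨j, h1, h2, h3⟩ := hT (U + i) (by omega)
  refine ⟨j - U, by omega, by omega, fun k hk => ?_⟩
  rw [← hag (j - U + k) (by omega), ← hag (i + k) (by omega),
    show U + (j - U + k) = j + k by omega, h3 k hk, Nat.add_assoc]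

theorem Chain.recursWithin {u : List (Fin 3)} {n₀ n₁ n₂ : ℕ} (hc : Chain u n₀ n₁ n₂) :
    RecursWithin p (u.length + 1) (n₀ + n₁ + n₂) := by
  obtain ⟨T, hT⟩ := hc.exists_recur
  exact recursWithin_of_eventually hT

/-! ### Lower bounds: desubstitution of two-sided extensions -/

/-- An occurrence at `t` of `w`, preceded by the letter `a` and followed by the letter `c`. -/
def Ext (a : Fin 3) (w : List (Fin 3)) (c : Fin 3) (t : ℕ) : Prop :=
  ∃ u, t = u + 1 ∧ p u = a ∧ Occ w t ∧ p (t + w.length) = c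

/-- The letter `a` before a word starting with `x` is revealed by the letter `a'` before its image.
-/
def LeftLift (x a a' : Fin 3) : Prop :=
  (x = 1 ∧ ((a = 0 ∧ a' = 1) ∨ (a = 2 ∧ a' = 0))) ∨
  (x = 2 ∧ ((a = 1 ∧ a' = 2) ∨ (a = 0 ∧ a' = 0)))

/-- The letter `c` after a word ending with `y` is revealed by the letter `c'` after its image. -/
def RightLift (y c c' : Fin 3) : Prop :=
  (y = 0 ∧ ((c = 1 ∧ c' = 2) ∨ (c = 2 ∧ c' = 0))) ∨
  (y = 1 ∧ ((c = 2 ∧ c' = 2) ∨ (c = 0 ∧ c' = 1)))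

instance (x a a' : Fin 3) : Decidable (LeftLift x a a') :=
  inferInstanceAs (Decidable (_ ∨ _))

instance (y c c' : Fin 3) : Decidable (RightLift y c c') :=
  inferInstanceAs (Decidable (_ ∨ _))

theorem LeftLift.forward {a a' : Fin 3} {u : ℕ} (hl : LeftLift (p (u + 1)) a a') (hu : p u = a) :
    ∃ v, ψ (u + 1) = v + 1 ∧ p v = a' := by
  rcases hl with ⟨hx, ⟨rfl, rfl⟩ | ⟨rfl, rfl⟩⟩ | ⟨hx, ⟨rfl, rfl⟩ | ⟨rfl, rfl⟩⟩
  · exact ⟨H u + 1, by simp [ψ, hx, (block0 hu).1], (block0 hu).2.2⟩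
  · exact ⟨H u, by simp [ψ, hx, (block2 hu).1], (block2 hu).2⟩
  · exact ⟨H u, by simp [ψ, hx, (block1 hu).1], (block1 hu).2.1⟩
  · exact ⟨H u, by simp [ψ, hx, (block0 hu).1], (block0 hu).2.1⟩

/-- Since `11` and `22` do not occur, only two letters can precede `p t`, and their lifts differ. -/
theorem LeftLift.backward (a a' : Fin 3) {t v : ℕ} (hl : LeftLift (p t) a a')
    (hv : ψ t = v + 1) (hva : p v = a') : ∃ u, t = u + 1 ∧ p u = a := by
  cases t with
  | zero => simp [ψ, H] at hv
  | succ u =>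
    refine ⟨u, rfl, ?_⟩
    have aux : ∀ b b', LeftLift (p (u + 1)) b b' → p u = b → b' = a' := by
      intro b b' hb hu
      obtain ⟨v', h1, h2⟩ := hb.forward hu
      rw [← hva, ← h2, show v' = v by omega]
    have n1 : p (u + 1) = 1 → p u ≠ 1 := fun h1 h2 => next_of_one h2 h1
    have n2 : p (u + 1) = 2 → p u ≠ 2 := fun h1 h2 => by simp [next_of_two h2] at h1
    generalize p u = b at *
    generalize p (u + 1) = x at *
    clear hv hva
    revert x a a' b
    decide

theorem RightLift.forward {c c' : Fin 3} {m : ℕ} (hr : RightLift (p m) c c')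
    (hc : p (m + 1) = c) : p (H (m + 1) + if p m = 1 then 1 else 0) = c' := by
  rcases hr with ⟨hx, ⟨rfl, rfl⟩ | ⟨rfl, rfl⟩⟩ | ⟨hx, ⟨rfl, rfl⟩ | ⟨rfl, rfl⟩⟩
  · simp [hx, (block1 hc).2.1]
  · simp [hx, (block2 hc).2]
  · simp [hx, ← (block2 hc).1, (block1 (next_of_two hc)).2.1]
  · simp [hx, (block0 hc).2.2]

theorem RightLift.backward (c c' : Fin 3) {m : ℕ} (hr : RightLift (p m) c c')
    (hc : p (H (m + 1) + if p m = 1 then 1 else 0) = c') : p (m + 1) = c := by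
  have aux : ∀ b b', RightLift (p m) b b' → p (m + 1) = b → b' = c' := by
    intro b b' hb hu
    rw [← hc, hb.forward hu]
  have n0 : p m = 0 → p (m + 1) ≠ 0 := next_of_zero
  have n1 : p m = 1 → p (m + 1) ≠ 1 := next_of_one
  generalize p (m + 1) = b at *
  generalize p m = y at *
  clear hc
  revert y c c' b
  decide

theorem ne_one_of_occ_h {b : Fin 3} {s : ℕ} (hb : Occ (h b) s) : p s ≠ 1 := by
  rcases fin3 b with rfl | rfl | rfl <;> simp [h, Occ] at hb <;> simp [hb]

/-- Blocks start exactly at letters other than `1`, so the parsing is unique. The end condition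
keeps a final `0 = h 2` from being the first half of `01 = h 0`. -/
theorem occ_of_occ_flatMap {w : List (Fin 3)} {t : ℕ} (hw : Occ (w.flatMap h) (H t))
    (hend : p (H t + (w.flatMap h).length) ≠ 1) : Occ w t := by
  induction w generalizing t with
  | nil => trivial
  | cons a w ih =>
    rw [List.flatMap_cons, occ_append] at hw
    rw [List.flatMap_cons, List.length_append, ← Nat.add_assoc] at hend
    have hcut : p (H t + (h a).length) ≠ 1 := by
      cases w with
      | nil => simpa using hend
      | cons b w =>
        have h2 := hw.2
        rw [List.flatMap_cons, occ_append] at h2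
        exact ne_one_of_occ_h h2.1
    have ha : p t = a := by
      have h1 := hw.1
      have h2 := hcut
      rcases fin3 (p t) with ht | ht | ht
      · obtain ⟨-, e0, e1⟩ := block0 ht
        rcases fin3 a with rfl | rfl | rfl <;> (simp [h, Occ, e0, e1] at h1 h2 ⊢; try exact ht)
      · obtain ⟨-, e0, e1⟩ := block1 ht
        rcases fin3 a with rfl | rfl | rfl <;> (simp [h, Occ, e0, e1] at h1 h2 ⊢; try exact ht)
      · obtain ⟨e, e0⟩ := block2 ht
        have e1 : p (H t + 1) ≠ 1 := e ▸ p_H_ne_one (t + 1)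
        rcases fin3 a with rfl | rfl | rfl <;> (simp [h, Occ, e0, e1] at h1 h2 ⊢; try exact ht)
    have e : H t + (h a).length = H (t + 1) := by rw [H, ha]
    rw [e] at hw hend
    exact ⟨ha, ih hw.2 hend⟩

theorem exists_of_occ_F {w : List (Fin 3)} {s : ℕ} (hne : w ≠ []) (hw : Occ (F w) s)
    (hend : w.getLast? ≠ some 1 → p (s + (F w).length) ≠ 1) : ∃ t, s = ψ t ∧ Occ w t := by
  rw [F, List.append_assoc, occ_append, occ_append] at hw
  obtain ⟨h1, h2, h3⟩ := hw
  set q := s + (if w.head? = some 2 then [(1 : Fin 3)] else []).length with hq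
  have hq1 : p q ≠ 1 := by
    cases w with
    | nil => exact absurd rfl hne
    | cons b w =>
      rw [List.flatMap_cons, occ_append] at h2
      exact ne_one_of_occ_h h2.1
  obtain ⟨t, ht⟩ := exists_eq_H hq1
  rw [ht] at h2 h3
  have hend' : p (H t + (w.flatMap h).length) ≠ 1 := by
    by_cases hL : w.getLast? = some 1
    · rw [if_pos hL] at h3
      rw [h3.1]
      decide
    · have := hend hL
      rw [F, if_neg hL, List.append_nil, List.length_append, ← Nat.add_assoc, ← hq, ht] at this
      exact this
  have hocc := occ_of_occ_flatMap h2 hend'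
  refine ⟨t, ?_, hocc⟩
  have e := ψ_add t
  rw [hocc.head?_eq hne] at hq
  by_cases h2 : p t = 2 <;> simp [h2] at e hq <;> omega

theorem Ext.map {a a' c c' x y : Fin 3} {w : List (Fin 3)} (hx : w.head? = some x)
    (hy : w.getLast? = some y) (hl : LeftLift x a a') (hr : RightLift y c c') {t : ℕ}
    (ht : Ext a w c t) : Ext a' (F w) c' (ψ t) := by
  obtain ⟨u, rfl, hu, hw, hc⟩ := ht
  have hne : w ≠ [] := by rintro rfl; simp at hx
  obtain ⟨m, hm, -, hL⟩ := hw.exists_last hne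
  rw [hw.head?_eq hne, Option.some.injEq] at hx
  rw [hL, Option.some.injEq] at hy
  subst hx hy
  obtain ⟨v, hv, hva⟩ := hl.forward hu
  refine ⟨v, hv, hva, occ_F hw hne, ?_⟩
  rw [ψ_add_length hw hne hm hL]
  exact hr.forward (hm ▸ hc)

theorem Ext.exists_of_map {a a' c c' x y : Fin 3} {w : List (Fin 3)} (hx : w.head? = some x)
    (hy : w.getLast? = some y) (hl : LeftLift x a a') (hr : RightLift y c c') {s : ℕ}
    (hs : Ext a' (F w) c' s) : ∃ t, s = ψ t ∧ Ext a w c t := by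
  obtain ⟨v, hv, hva, hw, hc⟩ := hs
  have hne : w ≠ [] := by rintro rfl; simp at hx
  -- If `y ≠ 1`, then `RightLift` forces `y = 0` and `c'` is `2` or `0`.
  obtain ⟨t, rfl, hocc⟩ := exists_of_occ_F hne hw (by
    rw [hy, hc]
    revert hr
    clear * -
    revert y c c'
    decide)
  obtain ⟨m, hm, -, hL⟩ := hocc.exists_last hne
  rw [hocc.head?_eq hne, Option.some.injEq] at hx
  rw [hL, Option.some.injEq] at hy
  subst hx hy
  obtain ⟨u, hu, hua⟩ := LeftLift.backward _ _ hl hv hva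
  rw [ψ_add_length hocc hne hm hL] at hc
  exact ⟨t, rfl, u, hu, hua, hocc, hm ▸ RightLift.backward _ _ hr hc⟩

/-- Two consecutive occurrences of `a w c` are separated by a word with `n₀, n₁, n₂` letters
`0, 1, 2`. -/
def Gap (a : Fin 3) (w : List (Fin 3)) (c : Fin 3) (n₀ n₁ n₂ : ℕ) : Prop :=
  ∃ t t', t < t' ∧ Ext a w c t ∧ Ext a w c t' ∧ (∀ v, t < v → v < t' → ¬ Ext a w c v) ∧
    Z 0 t' = Z 0 t + n₀ ∧ Z 1 t' = Z 1 t + n₁ ∧ Z 2 t' = Z 2 t + n₂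

theorem Gap.map {a a' c c' x y : Fin 3} {w : List (Fin 3)} {n₀ n₁ n₂ : ℕ} (hx : w.head? = some x)
    (hy : w.getLast? = some y) (hl : LeftLift x a a') (hr : RightLift y c c')
    (hg : Gap a w c n₀ n₁ n₂) : Gap a' (F w) c' (n₀ + n₂) (n₀ + n₁) n₁ := by
  obtain ⟨t, t', hlt, h1, h2, h3, h4⟩ := hg
  refine ⟨ψ t, ψ t', ψ_strictMono hlt, h1.map hx hy hl hr, h2.map hx hy hl hr, ?_, ?_⟩
  · intro v hv1 hv2 hv
    obtain ⟨z, rfl, hz⟩ := hv.exists_of_map hx hy hl hr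
    exact h3 z (ψ_strictMono.lt_iff_lt.1 hv1) (ψ_strictMono.lt_iff_lt.1 hv2) hz
  · have hne : w ≠ [] := by rintro rfl; simp at hx
    obtain ⟨-, -, -, o1, -⟩ := h1
    obtain ⟨-, -, -, o2, -⟩ := h2
    have e : p t' = p t := by
      have := o1.head?_eq hne
      rw [o2.head?_eq hne] at this
      simpa using this
    have z1 := Z_ψ t
    have z2 := Z_ψ t'
    rw [e] at z2
    omega

theorem Gap.not_recursWithin {a c : Fin 3} {w : List (Fin 3)} {n₀ n₁ n₂ m : ℕ}
    (hg : Gap a w c n₀ n₁ n₂) (hm : m < n₀ + n₁ + n₂) : ¬ RecursWithin p (w.length + 2) m := by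
  obtain ⟨t, t', hlt, ⟨u, rfl, hu, hw, hc⟩, -, h3, h4⟩ := hg
  intro hR
  obtain ⟨j, hj1, hj2, hj⟩ := hR u
  have z1 := Z_sum (u + 1)
  have z2 := Z_sum t'
  refine h3 (j + 1) (by omega) (by omega) ⟨j, rfl, ?_, hw.of_agree fun k hk => ?_, ?_⟩
  · rw [← hu]
    simpa using hj 0 (by omega)
  · have := hj (k + 1) (by omega)
    rwa [show j + 1 + k = j + (k + 1) by omega, show u + 1 + k = u + (k + 1) by omega]
  · have := hj (w.length + 1) (by omega)
    rw [← hc, show j + 1 + w.length = j + (w.length + 1) by omega, this]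
    congr 1
    omega

/-! ### Finite checks on all factors of length 22 -/

/-- The `k`-th iterate of `h` on words. -/
def hPow (k : ℕ) (w : List (Fin 3)) : List (Fin 3) := (fun v => v.flatMap h)^[k] w

theorem occ_hPow {w : List (Fin 3)} {s : ℕ} (hw : Occ w s) (k : ℕ) :
    Occ (hPow k w) (H^[k] s) ∧ H^[k] (s + w.length) = H^[k] s + (hPow k w).length := by
  induction k generalizing w s with
  | zero => exact ⟨hw, rfl⟩
  | succ k ih =>
    obtain ⟨h1, h2⟩ := occ_map hw
    obtain ⟨h3, h4⟩ := ih h1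
    simp only [Function.iterate_succ_apply, h2, h4, hPow] at *
    exact ⟨h3, trivial⟩

theorem exists_hPow_block (k i : ℕ) :
    ∃ t r, i = H^[k] t + r ∧ r < (hPow k [p t]).length := by
  have hmono : StrictMono (H^[k]) := H_strictMono.iterate k
  have hstep : ∀ t, H^[k] (t + 1) = H^[k] t + (hPow k [p t]).length := fun t =>
    (occ_hPow (w := [p t]) ⟨rfl, trivial⟩ k).2
  have h0 : H^[k] 0 = 0 := Function.iterate_fixed rfl k
  induction i with
  | zero =>
    refine ⟨0, 0, by omega, ?_⟩
    have h1 := hmono (show 0 < 1 by omega)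
    have h2 := hstep 0
    rw [Nat.zero_add] at h2
    omega
  | succ i ih =>
    obtain ⟨t, r, h1, h2⟩ := ih
    by_cases hr : r + 1 < (hPow k [p t]).length
    · exact ⟨t, r + 1, by omega, hr⟩
    · have h3 := hstep t
      have h4 := hstep (t + 1)
      have h5 := hmono (show t + 1 < t + 1 + 1 by omega)
      exact ⟨t + 1, 0, by omega, by omega⟩

theorem Occ.drop {w : List (Fin 3)} {s : ℕ} (hw : Occ w s) {r : ℕ} (hr : r ≤ w.length) :
    Occ (w.drop r) (s + r) := by
  have := hw
  rw [← List.take_append_drop r w, occ_append, List.length_take, Nat.min_eq_left hr] at this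
  exact this.2

theorem Occ.take {w : List (Fin 3)} {s : ℕ} (hw : Occ w s) (r : ℕ) : Occ (w.take r) s := by
  rw [← List.take_append_drop r w, occ_append] at hw
  exact hw.1

theorem Occ.eq_of_length {u v : List (Fin 3)} {s : ℕ} (hu : Occ u s) (hv : Occ v s)
    (hl : u.length = v.length) : u = v := by
  rw [occ_iff] at hu hv
  exact List.ext_getElem hl fun k h1 h2 => by rw [hu k h1, hv k h2]

theorem Occ.occ_iff_take {w l : List (Fin 3)} {s : ℕ} (hl : Occ l s) (hle : w.length ≤ l.length) :
    Occ w s ↔ l.take w.length = w := by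
  constructor
  · intro hw
    exact (hl.take _).eq_of_length hw (by simpa using hle)
  · intro he
    rw [← he]
    exact hl.take _

/-- The factors of length `22` of the images under `h^6` of the factors of length two of `p`. -/
def windows : List (List (Fin 3)) :=
  [(0, 1), (0, 2), (1, 0), (1, 2), (2, 1)].flatMap fun (xy : Fin 3 × Fin 3) =>
    (List.range (hPow 6 [xy.1]).length).map fun r => ((hPow 6 [xy.1, xy.2]).drop r).take 22

/-- The shortest sixth image, that of `2`, has 21 letters, so 22 letters remain even from the last
letter of the first image. The checks below need 22: a word of length 6 recurring at distance up to
16. -/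
theorem length_of_mem_windows : ∀ l ∈ windows, l.length = 22 := by decide +kernel

theorem exists_window (i : ℕ) : ∃ l ∈ windows, l.length = 22 ∧ Occ l i := by
  obtain ⟨t, r, rfl, hr⟩ := exists_hPow_block 6 i
  have hocc := (occ_hPow (w := [p t, p (t + 1)]) ⟨rfl, rfl, trivial⟩ 6).1
  have hlen : r ≤ (hPow 6 [p t, p (t + 1)]).length := by
    have h1 := (occ_hPow (w := [p t]) ⟨rfl, trivial⟩ 6).2
    have h2 := (occ_hPow (w := [p t, p (t + 1)]) ⟨rfl, rfl, trivial⟩ 6).2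
    have h3 := (H_strictMono.iterate 6) (show t + 1 < t + 2 by omega)
    simp only [List.length_cons, List.length_nil, Nat.zero_add, Nat.reduceAdd] at h1 h2
    omega
  have hmem : ((hPow 6 [p t, p (t + 1)]).drop r).take 22 ∈ windows := by
    refine List.mem_flatMap.2 ⟨(p t, p (t + 1)), ?_, List.mem_map.2 ⟨r, List.mem_range.2 hr, rfl⟩⟩
    have n0 := next_of_zero (n := t)
    have n1 := next_of_one (n := t)
    have n2 := next_of_two (n := t)
    generalize p t = x at *
    generalize p (t + 1) = y at *
    clear hocc hr hlen
    revert x y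
    decide
  exact ⟨_, hmem, length_of_mem_windows _ hmem, (hocc.drop hlen).take 22⟩

theorem recursWithin_of_windows {n m : ℕ} (hnm : n + m ≤ 22)
    (hd : ∀ l ∈ windows, ∃ d ∈ List.range (m + 1), 0 < d ∧ (l.drop d).take n = l.take n) :
    RecursWithin p n m := by
  intro i
  obtain ⟨l, hl, h22, hocc⟩ := exists_window i
  obtain ⟨d, hd1, hd2, hd3⟩ := hd l hl
  rw [List.mem_range] at hd1
  refine ⟨i + d, by omega, by omega, fun k hk => ?_⟩
  have h1 := (hocc.drop (r := d) (by omega)).take n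
  rw [hd3] at h1
  exact (hocc.take n).agree h1 k (by simp; omega)

theorem exists_return_of_windows {w : List (Fin 3)} {n₀ n₁ n₂ : ℕ} (hw : w.length ≤ 22)
    (hd : ∀ l ∈ windows, l.take w.length = w → ∃ d ∈ List.range (23 - w.length), 0 < d ∧
      (l.drop d).take w.length = w ∧ (l.take d).count 0 ≤ n₀ ∧ (l.take d).count 1 ≤ n₁ ∧
      (l.take d).count 2 ≤ n₂) {s : ℕ} (hs : Occ w s) :
    ∃ s', s < s' ∧ Occ w s' ∧ Z 0 s' ≤ Z 0 s + n₀ ∧ Z 1 s' ≤ Z 1 s + n₁ ∧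
      Z 2 s' ≤ Z 2 s + n₂ := by
  obtain ⟨l, hl, h22, hocc⟩ := exists_window s
  obtain ⟨d, hd1, hd2, hd3, h0, h1, h2⟩ := hd l hl ((hocc.occ_iff_take (by omega)).1 hs)
  rw [List.mem_range] at hd1
  have hZ := Z_add_length (hocc.take d)
  rw [List.length_take, h22, Nat.min_eq_left (by omega)] at hZ
  refine ⟨s + d, by omega, hd3 ▸ (hocc.drop (by omega)).take _, ?_⟩
  rw [hZ, hZ, hZ]
  omega

theorem chain_of_windows {u : List (Fin 3)} {W : List (List (Fin 3))} {n₀ n₁ n₂ : ℕ}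
    (hu : ∃ s, Occ u s) (hule : u.length ≤ 22)
    (hW : ∀ w ∈ W, u.length < w.length ∧ w.length ≤ 22 ∧ w.drop (w.length - u.length) = u)
    (hnext : ∀ l ∈ windows, l.take u.length = u → ∃ w ∈ W, l.take w.length = w)
    (hret : ∀ w ∈ W, ∀ l ∈ windows, l.take w.length = w → ∃ d ∈ List.range (23 - w.length), 0 < d ∧
      (l.drop d).take w.length = w ∧ (l.take d).count 0 ≤ n₀ ∧ (l.take d).count 1 ≤ n₁ ∧
      (l.take d).count 2 ≤ n₂) : Chain u n₀ n₁ n₂ := by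
  have hstep : ∀ s, Occ u s → ∃ w ∈ W, Occ w s := by
    intro s hs
    obtain ⟨l, hl, h22, hocc⟩ := exists_window s
    obtain ⟨w, hw, he⟩ := hnext l hl ((hocc.occ_iff_take (by omega)).1 hs)
    exact ⟨w, hw, he ▸ hocc.take _⟩
  refine ⟨fun s w => w ∈ W ∧ Occ w s, ?_, ?_⟩
  · obtain ⟨s, hs⟩ := hu
    obtain ⟨w, hw, hocc⟩ := hstep s hs
    exact ⟨s, w, hw, hocc⟩
  · rintro s w ⟨hw, hocc⟩
    obtain ⟨h1, h2, h3⟩ := hW w hw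
    have hq := hocc.drop (r := w.length - u.length) (by omega)
    rw [h3] at hq
    obtain ⟨w', hw', hocc'⟩ := hstep _ hq
    refine ⟨List.length_pos_iff.1 (by omega), hocc, ⟨_, w', _, ⟨hw', hocc'⟩, by omega, le_rfl, hq,
      by omega⟩, exists_return_of_windows h2 (hret w hw) hocc⟩

/-- `W` lists the complete return words of `1`; likewise for `10` in `chain_one_zero`. -/
theorem chain_one : Chain [1] 4 5 3 :=
  chain_of_windows (W := [[1, 2, 1], [1, 0, 1], [1, 0, 2, 1]]) ⟨1, by decide, trivial⟩ (by decide)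
    (by decide +kernel) (by decide +kernel) (by decide +kernel)

theorem chain_one_zero : Chain [1, 0] 5 7 4 :=
  chain_of_windows (W := [[1, 0, 1, 0], [1, 0, 2, 1, 0], [1, 0, 1, 2, 1, 0]])
    ⟨3, by decide, by decide, trivial⟩ (by decide)
    (by decide +kernel) (by decide +kernel) (by decide +kernel)

/-! ### Explicit gaps in the prefix of length 200 -/

theorem length_hIter_nine : (hIter 9).length = 200 := by decide +kernel

theorem occ_drop_hIter_nine {i : ℕ} (hi : i ≤ 200) : Occ ((hIter 9).drop i) i := by
  simpa using (occ_hIter 9).drop (r := i) (by rwa [length_hIter_nine])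

theorem not_recursWithin_of_prefix (i : ℕ) {n m : ℕ} (hnm : i + m + n ≤ 200)
    (hd : ∀ d ∈ List.range (m + 1), 0 < d →
      ((hIter 9).drop (i + d)).take n ≠ ((hIter 9).drop i).take n) : ¬ RecursWithin p n m := by
  intro hR
  obtain ⟨j, h1, h2, h3⟩ := hR i
  obtain ⟨d, rfl⟩ := Nat.exists_eq_add_of_le h1.le
  have o1 := (occ_drop_hIter_nine (i := i) (by omega)).take n
  have o2 := (occ_drop_hIter_nine (i := i + d) (by omega)).take n
  refine hd d (List.mem_range.2 (by omega)) (by omega) (o2.eq_of_length (o1.of_agree fun k hk => ?_)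
    (by simp [length_hIter_nine]; omega))
  exact h3 k (hk.trans_le (List.length_take_le _ _))

theorem gap_of_prefix (u u' : ℕ) {a c : Fin 3} {w V : List (Fin 3)} {n₀ n₁ n₂ : ℕ}
    (hV : V = a :: (w ++ [c])) (huu : u < u') (hle : u' + V.length ≤ 200)
    (h1 : ((hIter 9).drop u).take V.length = V) (h2 : ((hIter 9).drop u').take V.length = V)
    (h3 : ∀ v ∈ List.range u', u < v → ((hIter 9).drop v).take V.length ≠ V)
    (hc : ∀ x : Fin 3, ((hIter 9).take (u' + 1)).count x =
      ((hIter 9).take (u + 1)).count x + ![n₀, n₁, n₂] x) : Gap a w c n₀ n₁ n₂ := by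
  have hExt : ∀ v, v ≤ u' →
      (Ext a w c (v + 1) ↔ ((hIter 9).drop v).take V.length = V) := by
    intro v hv
    rw [← (occ_drop_hIter_nine (i := v) (by omega)).occ_iff_take
      (by simp [length_hIter_nine]; omega), hV, Occ, occ_append]
    constructor
    · rintro ⟨z, hz, h1, h2, h3⟩
      obtain rfl : v = z := by omega
      exact ⟨h1, h2, h3, trivial⟩
    · rintro ⟨h1, h2, h3, -⟩
      exact ⟨v, rfl, h1, h2, h3⟩
  have hZ : ∀ v, v ≤ 200 → ∀ x, Z x v = ((hIter 9).take v).count x := by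
    intro v hv x
    have := Z_add_length ((occ_hIter 9).take v) x
    rwa [List.length_take, length_hIter_nine, Nat.min_eq_left hv, Nat.zero_add, Z,
      Nat.zero_add] at this
  have hVl : V.length = w.length + 2 := by simp [hV]
  refine ⟨u + 1, u' + 1, by omega, (hExt u huu.le).2 h1, (hExt u' le_rfl).2 h2, ?_, ?_⟩
  · intro v hv1 hv2 hv
    obtain ⟨z, rfl⟩ := Nat.exists_eq_add_of_le' (show 1 ≤ v by omega)
    exact h3 z (List.mem_range.2 (by omega)) (by omega) ((hExt z (by omega)).1 hv)
  · simp only [hZ (u + 1) (by omega), hZ (u' + 1) (by omega), hc]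
    simp

theorem gap_one : Gap 0 [1] 0 5 7 4 :=
  gap_of_prefix 16 32 rfl (by decide) (by decide) (by decide +kernel) (by decide +kernel)
    (by decide +kernel) (by decide +kernel)

theorem gap_one_zero : Gap 2 [1, 0] 2 7 9 5 :=
  gap_of_prefix 2 23 rfl (by decide) (by decide) (by decide +kernel) (by decide +kernel)
    (by decide +kernel) (by decide +kernel)

/-! ### Values of R from matching bounds -/

theorem R_eq {n m : ℕ} (hm : 0 < m) (h1 : RecursWithin p n m)
    (h2 : ∀ m', m' < m → ¬ RecursWithin p n m') : R p n = m := by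
  refine le_antisymm (Nat.sInf_le ⟨hm, h1⟩) (le_csInf ⟨m, hm, h1⟩ ?_)
  rintro m' ⟨-, hm'⟩
  by_contra hlt
  exact h2 m' (by omega) hm'

theorem RecursWithin.mono {n n' m m' : ℕ} (hR : RecursWithin p n m) (hn : n' ≤ n) (hm : m ≤ m') :
    RecursWithin p n' m' := by
  intro i
  obtain ⟨j, h1, h2, h3⟩ := hR i
  exact ⟨j, h1, by omega, fun k hk => h3 k (by omega)⟩

theorem R_one : R p 1 = 5 :=
  R_eq (by decide) (recursWithin_of_windows (by decide) (by decide +kernel)) fun m' hm' hR =>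
    not_recursWithin_of_prefix 5 (n := 1) (m := 4) (by decide) (by decide +kernel)
      (hR.mono le_rfl (by omega))

theorem R_two : R p 2 = 12 :=
  R_eq (by decide) (recursWithin_of_windows (by decide) (by decide +kernel)) fun m' hm' hR =>
    not_recursWithin_of_prefix 1 (n := 2) (m := 11) (by decide) (by decide +kernel)
      (hR.mono le_rfl (by omega))

/-! ### Bispecial factors and their return lengths -/

/-- The bispecial factors of `p`, by increasing length. -/
def bisp : ℕ → List (Fin 3)
  | 0 => [1]
  | 1 => [1, 0]
  | k + 2 => F (bisp k)

/-- The numbers of letters `0, 1, 2` in the longest return word of `bisp k`. -/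
def ret : ℕ → ℕ × ℕ × ℕ
  | 0 => (1, 1, 1)
  | 1 => (1, 2, 1)
  | k + 2 => ((ret k).1 + (ret k).2.2, (ret k).1 + (ret k).2.1, (ret k).2.1)

/-- The length of the longest return word of `bisp k`. -/
def g (k : ℕ) : ℕ := (ret k).1 + (ret k).2.1 + (ret k).2.2

/-- Both sides evolve by the same matrix when `k` grows by 2, so two base cases suffice. -/
theorem ret_add_five (k : ℕ) : (ret (k + 5)).1 = (ret (k + 4)).1 + (ret k).1 ∧
    (ret (k + 5)).2.1 = (ret (k + 4)).2.1 + (ret k).2.1 ∧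
    (ret (k + 5)).2.2 = (ret (k + 4)).2.2 + (ret k).2.2 := by
  induction k using Nat.twoStepInduction with
  | zero => decide
  | one => decide
  | more k ih _ =>
    have e1 : ret (k + 2 + 5) = _ := ret.eq_3 (k + 5)
    have e2 : ret (k + 2 + 4) = _ := ret.eq_3 (k + 4)
    have e3 := ret.eq_3 k
    rw [e1, e2, e3]
    simp only
    omega

theorem g_add_five (k : ℕ) : g (k + 5) = g (k + 4) + g k := by
  have := ret_add_five k
  unfold g
  omega

theorem bisp_ne_nil (k : ℕ) : bisp k ≠ [] := by
  induction k using Nat.twoStepInduction with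
  | zero => decide
  | one => decide
  | more k ih _ => exact F_ne_nil ih

theorem chain_bisp (k : ℕ) :
    Chain (bisp k) (ret (k + 5)).1 (ret (k + 5)).2.1 (ret (k + 5)).2.2 := by
  induction k using Nat.twoStepInduction with
  | zero => exact chain_one
  | one => exact chain_one_zero
  | more k ih _ => exact ih.map (bisp_ne_nil k)

theorem head?_F {w : List (Fin 3)} {x : Fin 3} (hx : w.head? = some x) (h0 : x ≠ 0) :
    (F w).head? = some (if x = 2 then 1 else 2) := by
  cases w with
  | nil => simp at hx
  | cons a w =>
    obtain rfl : a = x := by simpa using hx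
    rcases fin3 a with rfl | rfl | rfl <;> simp [F, h] at h0 ⊢

theorem getLast?_F {w : List (Fin 3)} {y : Fin 3} (hy : w.getLast? = some y) (h0 : y ≠ 2) :
    (F w).getLast? = some (if y = 1 then 0 else 1) := by
  obtain ⟨v, rfl⟩ := List.getLast?_eq_some_iff.1 hy
  rcases fin3 y with rfl | rfl | rfl <;> simp [F, h] at h0 ⊢

/-- The liftability of `a` and `c` is carried along so that `Gap.map` applies again; lifted letters
are always liftable. -/
theorem gap_bisp (k : ℕ) : ∃ a c x y, (bisp k).head? = some x ∧ (bisp k).getLast? = some y ∧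
    (∃ a', LeftLift x a a') ∧ (∃ c', RightLift y c c') ∧
    Gap a (bisp k) c (ret (k + 6)).1 (ret (k + 6)).2.1 (ret (k + 6)).2.2 := by
  induction k using Nat.twoStepInduction with
  | zero => exact ⟨0, 0, 1, 1, rfl, rfl, by decide, by decide, gap_one⟩
  | one => exact ⟨2, 2, 1, 0, rfl, rfl, by decide, by decide, gap_one_zero⟩
  | more k ih _ =>
    obtain ⟨a, c, x, y, hx, hy, ⟨a', ha⟩, ⟨c', hc⟩, hg⟩ := ih
    have hl : ∀ x a a', LeftLift x a a' →
        x ≠ 0 ∧ ∃ a'', LeftLift (if x = 2 then 1 else 2) a' a'' := by decide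
    have hr : ∀ y c c', RightLift y c c' →
        y ≠ 2 ∧ ∃ c'', RightLift (if y = 1 then 0 else 1) c' c'' := by decide
    obtain ⟨x0, hl⟩ := hl _ _ _ ha
    obtain ⟨y0, hr⟩ := hr _ _ _ hc
    exact ⟨a', c', _, _, head?_F hx x0, getLast?_F hy y0, hl, hr, hg.map hx hy ha hc⟩

theorem count_F (w : List (Fin 3)) :
    (F w).count 0 = w.count 0 + w.count 2 + (if w.getLast? = some 1 then 1 else 0) ∧
    (F w).count 1 = w.count 0 + w.count 1 + (if w.head? = some 2 then 1 else 0) ∧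
    (F w).count 2 = w.count 1 := by
  have key : ∀ w : List (Fin 3), (w.flatMap h).count 0 = w.count 0 + w.count 2 ∧
      (w.flatMap h).count 1 = w.count 0 + w.count 1 ∧ (w.flatMap h).count 2 = w.count 1 := by
    intro w
    induction w with
    | nil => decide
    | cons a w ih =>
      rcases fin3 a with rfl | rfl | rfl <;>
        simp [List.flatMap_cons, h] <;> omega
  obtain ⟨h0, h1, h2⟩ := key w
  simp only [F, List.count_append, h0, h1, h2]
  split_ifs <;> simp <;> omega

theorem length_eq_count (w : List (Fin 3)) : w.length = w.count 0 + w.count 1 + w.count 2 := by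
  induction w with
  | nil => rfl
  | cons a w ih =>
    rcases fin3 a with rfl | rfl | rfl <;> simp [ih] <;> omega

theorem bisp_add_four_ends (k : ℕ) : (bisp (k + 4)).head? = (bisp k).head? ∧
    (bisp (k + 4)).getLast? = (bisp k).getLast? := by
  obtain ⟨a, c, x, y, hx, hy, ⟨a', ha⟩, ⟨c', hc⟩, -⟩ := gap_bisp k
  have hx2 : x ≠ 0 ∧ (if x = 2 then (1 : Fin 3) else 2) ≠ 0 ∧
      (if (if x = 2 then (1 : Fin 3) else 2) = 2 then (1 : Fin 3) else 2) = x := by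
    rcases ha with ⟨rfl, -⟩ | ⟨rfl, -⟩ <;> decide
  have hy2 : y ≠ 2 ∧ (if y = 1 then (0 : Fin 3) else 1) ≠ 2 ∧
      (if (if y = 1 then (0 : Fin 3) else 1) = 1 then (0 : Fin 3) else 1) = y := by
    rcases hc with ⟨rfl, -⟩ | ⟨rfl, -⟩ <;> decide
  have e1 := head?_F (head?_F hx hx2.1) hx2.2.1
  have e2 := getLast?_F (getLast?_F hy hy2.1) hy2.2.1
  rw [hx2.2.2] at e1
  rw [hy2.2.2] at e2
  exact ⟨e1.trans hx.symm, e2.trans hy.symm⟩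

/-- Applying `F` twice restores the end letters, so the border corrections in `count_F` agree for
`bisp (k + 4)` and `bisp k`. Their difference thus evolves linearly, as `ret` does. -/
theorem bisp_add_four_count (k : ℕ) :
    (bisp (k + 4)).count 0 = (bisp k).count 0 + (ret (k + 2)).1 ∧
    (bisp (k + 4)).count 1 = (bisp k).count 1 + (ret (k + 2)).2.1 ∧
    (bisp (k + 4)).count 2 = (bisp k).count 2 + (ret (k + 2)).2.2 := by
  induction k using Nat.twoStepInduction with
  | zero => decide
  | one => decide
  | more k ih _ =>
    obtain ⟨e1, e2⟩ := bisp_add_four_ends k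
    have h1 := count_F (bisp (k + 4))
    have h2 := count_F (bisp k)
    rw [e1, e2] at h1
    change (F (bisp (k + 4))).count 0 = (F (bisp k)).count 0 + ((ret (k + 2)).1 + (ret (k + 2)).2.2) ∧
      (F (bisp (k + 4))).count 1 = (F (bisp k)).count 1 + ((ret (k + 2)).1 + (ret (k + 2)).2.1) ∧
      (F (bisp (k + 4))).count 2 = (F (bisp k)).count 2 + (ret (k + 2)).2.1
    omega

theorem length_bisp_add_four (k : ℕ) :
    (bisp (k + 4)).length = (bisp k).length + g (k + 2) := by
  have := bisp_add_four_count k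
  rw [length_eq_count, length_eq_count (bisp k), g]
  omega

theorem g_strictMono : StrictMono g := by
  refine strictMono_nat_of_lt_succ fun k => ?_
  have hpos : ∀ k, 0 < g k := by
    intro k
    induction k using Nat.twoStepInduction with
    | zero => decide
    | one => decide
    | more k ih _ =>
      simp only [g, ret] at ih ⊢
      omega
  match k with
  | 0 | 1 | 2 | 3 => decide
  | k + 4 =>
    have : g (k + 4 + 1) = _ := g_add_five k
    have := hpos k
    omega

theorem length_bisp_strictMono : StrictMono fun k => (bisp k).length := by
  refine strictMono_nat_of_lt_succ fun k => ?_
  induction k using Nat.strong_induction_on with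
  | _ k ih =>
    match k with
    | 0 | 1 | 2 | 3 => decide
    | k + 4 =>
      have h1 := length_bisp_add_four k
      have h2 : (bisp (k + 4 + 1)).length = _ := length_bisp_add_four (k + 1)
      have h3 : g (k + 2) < g (k + 1 + 2) := g_strictMono (by omega)
      have h4 : (bisp k).length < (bisp (k + 1)).length := ih k (by omega)
      omega

theorem recursWithin_bisp (k : ℕ) : RecursWithin p ((bisp k).length + 1) (g (k + 5)) :=
  (chain_bisp k).recursWithin

/-- The gap of an extension of `bisp k` equals the chain bound for `bisp (k + 1)`. -/
theorem R_eq_g {k n : ℕ} (h1 : (bisp k).length + 2 ≤ n) (h2 : n ≤ (bisp (k + 1)).length + 1) :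
    R p n = g (k + 6) := by
  refine R_eq (by have := g_strictMono (show 0 < k + 6 by omega); omega)
    ((recursWithin_bisp (k + 1)).mono h2 le_rfl) fun m' hm' hR => ?_
  obtain ⟨a, c, -, -, -, -, -, -, hg⟩ := gap_bisp k
  exact hg.not_recursWithin hm' (hR.mono h1 le_rfl)

/-! ### Translation into the sequences X, B and C -/

/-- The polynomial `x⁴ - x³ - x² - 1` is `x + 1` times the characteristic polynomial `x³ - 2x² + x -
1` of the incidence matrix. -/
theorem X_eq_g (m : ℕ) : X (m + 4) = g (2 * m + 3) := by
  induction m using Nat.strong_induction_on with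
  | _ m ih =>
    match m with
    | 0 | 1 | 2 | 3 => decide
    | m + 4 =>
      have h0 := ih m (by omega)
      have h2 : X (m + 2 + 4) = _ := ih (m + 2) (by omega)
      have h3 : X (m + 3 + 4) = _ := ih (m + 3) (by omega)
      have hX : X (m + 4 + 4) = X (m + 3 + 4) + X (m + 2 + 4) + X (m + 4) := rfl
      rw [hX, h0, h2, h3, show 2 * (m + 4) + 3 = 2 * m + 3 + 2 + 2 + 2 + 2 by ring,
        show 2 * (m + 3) + 3 = 2 * m + 3 + 2 + 2 + 2 by ring,
        show 2 * (m + 2) + 3 = 2 * m + 3 + 2 + 2 by ring]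
      simp only [g, ret]
      omega

theorem length_rep (i : ℕ) (w : List ℕ) : (rep i w).length = i * w.length := by
  simp [rep]

theorem rep_succ (i : ℕ) (w : List ℕ) : rep (i + 1) w = w ++ rep i w := by
  simp [rep, List.replicate_succ]

/-- One more block `01` leaves the old digits in place and puts a new leading `1` two places higher;
for `C`, a block `0010` puts it four places higher. -/
theorem B_add_two (m : ℕ) : B (m + 5) = B (m + 3) + X (m + 5) := by
  obtain ⟨i, rfl | rfl⟩ := Nat.even_or_odd' m
  · rw [B_odd i, show 2 * i + 5 = 2 * (i + 1) + 3 by ring, B_odd, rep_succ]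
    simp [val, length_rep]
    rw [show i * 2 + 1 + 1 + 1 + 1 + 1 = 2 * (i + 1) + 3 by ring,
      show i * 2 + 1 + 1 + 1 = 2 * i + 3 by ring]
    omega
  · rw [show 2 * i + 1 + 3 = 2 * i + 4 by ring, B_even i,
      show 2 * i + 1 + 5 = 2 * (i + 1) + 4 by ring, B_even, rep_succ]
    simp [val, length_rep]
    rw [show i * 2 + 1 + 1 + 1 + 1 + 1 + 1 = 2 * (i + 1) + 4 by ring,
      show i * 2 + 1 + 1 + 1 + 1 = 2 * i + 4 by ring]
    omega

theorem C_add_four (m : ℕ) : C (m + 6) = C (m + 2) + X (m + 6) := by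
  have e1 : (m + 6 - 2) / 4 = (m + 2 - 2) / 4 + 1 := by omega
  have e2 : (m + 6 - 2) % 4 = (m + 2 - 2) % 4 := by omega
  have e3 : (cTail ((m + 2 - 2) % 4)).length = (m + 2 - 2) % 4 := by
    have : (m + 2 - 2) % 4 < 4 := Nat.mod_lt _ (by omega)
    interval_cases (m + 2 - 2) % 4 <;> rfl
  rw [C, C, e1, e2, rep_succ]
  simp [val, length_rep] at e3 ⊢
  rw [e3, show m / 4 * 4 + m % 4 + 1 + 1 + 1 + 1 + 1 + 1 = m + 6 by omega,
    show m / 4 * 4 + m % 4 + 1 + 1 = m + 2 by omega]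
  omega

theorem B_eq_length (m : ℕ) : B (m + 3) = (bisp (2 * m + 3)).length + 2 := by
  induction m using Nat.twoStepInduction with
  | zero => decide
  | one => decide
  | more m ih _ =>
    have h1 : B (m + 2 + 3) = _ := B_add_two m
    have h2 : X (m + 5) = _ := X_eq_g (m + 1)
    have h3 : (bisp (2 * (m + 2) + 3)).length = _ := length_bisp_add_four (2 * m + 3)
    rw [h1, h2, h3, ih, show 2 * (m + 1) + 3 = 2 * m + 3 + 2 by ring]
    omega

theorem C_eq_length (m : ℕ) : C (m + 2) = (bisp (2 * m)).length + 1 := by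
  induction m using Nat.strong_induction_on with
  | _ m ih =>
    match m with
    | 0 | 1 | 2 | 3 => decide
    | m + 4 =>
      have h0 := ih m (by omega)
      have h1 : C (m + 4 + 2) = _ := C_add_four m
      have h2 : X (m + 6) = g (2 * m + 2 + 5) := X_eq_g (m + 2)
      have h3 := length_bisp_add_four (2 * m)
      have h4 : (bisp (2 * (m + 4))).length = (bisp (2 * m + 4)).length + g (2 * m + 2 + 4) :=
        length_bisp_add_four (2 * m + 4)
      -- This splits `X (m + 6) = g (2 * m + 7)` into the two length increments of `h3` and `h4`.
      have h5 := g_add_five (2 * m + 2)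
      rw [h1, h2, h4, h3, h0, h5]
      omega

theorem existsUnique_mem_Ico {f : ℕ → ℕ} (hf : StrictMono f) {n : ℕ} (hn : f 0 ≤ n) :
    ∃! i, f i ≤ n ∧ n < f (i + 1) := by
  refine ⟨Nat.findGreatest (fun i => f i ≤ n) n,
    ⟨Nat.findGreatest_spec (P := fun i => f i ≤ n) (Nat.zero_le n) hn, ?_⟩, ?_⟩
  · by_contra hlt
    have h1 : f (Nat.findGreatest (fun i => f i ≤ n) n + 1) ≤ n := by omega
    have h2 := Nat.le_findGreatest (P := fun i => f i ≤ n) (hf.le_apply.trans h1) h1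
    omega
  · rintro j ⟨h1, h2⟩
    have h3 := Nat.le_findGreatest (P := fun i => f i ≤ n) (hf.le_apply.trans h1) h1
    have h4 := Nat.findGreatest_spec (P := fun i => f i ≤ n) (Nat.zero_le n) hn
    have h5 := hf.lt_iff_lt.1 (h4.trans_lt h2)
    omega

end TernaryWord

/-- The first conjunct says that the minimum defining `R(n)` exists; the second one says that for
`n ≥ 6` exactly one of the ranges in the last two lines contains `n`. -/
theorem theorem9 :
    (∀ n : ℕ, 1 ≤ n → ∃ m : ℕ, 0 < m ∧ TernaryWord.RecursWithin TernaryWord.p n m) ∧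
    (∀ n : ℕ, 6 ≤ n → ∃! i : ℕ, 3 ≤ i ∧
      ((TernaryWord.B i ≤ n ∧ n ≤ TernaryWord.C (i + 1)) ∨
        (TernaryWord.C (i + 1) < n ∧ n < TernaryWord.B (i + 1)))) ∧
    TernaryWord.R TernaryWord.p 1 = 5 ∧
    TernaryWord.R TernaryWord.p 2 = 12 ∧
    TernaryWord.R TernaryWord.p 3 = 16 ∧
    TernaryWord.R TernaryWord.p 4 = 21 ∧
    TernaryWord.R TernaryWord.p 5 = 28 ∧
    (∀ i n : ℕ, 3 ≤ i → TernaryWord.B i ≤ n → n ≤ TernaryWord.C (i + 1) →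
      TernaryWord.R TernaryWord.p n = TernaryWord.X (i + 4)) ∧
    (∀ i n : ℕ, 3 ≤ i → TernaryWord.C (i + 1) < n → n < TernaryWord.B (i + 1) →
      TernaryWord.R TernaryWord.p n = TernaryWord.X (i + 4) + TernaryWord.X (i + 2)) := by
  open TernaryWord in
  have hB := B_eq_length
  have hC : ∀ m, C (m + 3 + 1) = (bisp (2 * m + 4)).length + 1 := fun m => C_eq_length (m + 2)
  have hX : ∀ m, X (m + 3 + 4) = g (2 * m + 9) := fun m => X_eq_g (m + 3)
  have hlt : ∀ k, (bisp k).length < (bisp (k + 1)).length := fun k =>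
    length_bisp_strictMono k.lt_succ_self
  refine ⟨fun n _ => ⟨g (n + 5), ?_, ?_⟩, fun n hn => ?_, R_one, R_two,
    R_eq_g (k := 0) (by decide) (by decide), R_eq_g (k := 1) (by decide) (by decide),
    R_eq_g (k := 2) (by decide) (by decide), fun i n hi h1 h2 => ?_, fun i n hi h1 h2 => ?_⟩
  · have := g_strictMono (show 0 < n + 5 by omega)
    omega
  · have : n ≤ (bisp n).length := length_bisp_strictMono.le_apply
    exact (recursWithin_bisp n).mono (by omega) le_rfl
  · have hmono : StrictMono fun m => B (m + 3) := strictMono_nat_of_lt_succ fun m => by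
      have h1 := hB m
      have h2 := hB (m + 1)
      have h3 := length_bisp_strictMono (show 2 * m + 3 < 2 * (m + 1) + 3 by omega)
      simp only at h3 ⊢
      omega
    -- `C` falls between consecutive values of `B`, so the two ranges together fill the interval
    -- from one `B` to the next.
    have key : ∀ m, (B (m + 3) ≤ n ∧ n ≤ C (m + 3 + 1)) ∨
        (C (m + 3 + 1) < n ∧ n < B (m + 3 + 1)) ↔ B (m + 3) ≤ n ∧ n < B (m + 1 + 3) := by
      intro m
      rw [show m + 3 + 1 = m + 1 + 3 by ring, hB, hB, hC m]
      have h1 : (bisp (2 * m + 3)).length < (bisp (2 * m + 4)).length := hlt (2 * m + 3)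
      have h2 := hlt (2 * m + 4)
      rw [show 2 * (m + 1) + 3 = 2 * m + 4 + 1 by ring]
      omega
    obtain ⟨m, hm, huniq⟩ := existsUnique_mem_Ico hmono (n := n) ((show B 3 = 6 by decide) ▸ hn)
    refine ⟨m + 3, ⟨by omega, (key m).2 hm⟩, ?_⟩
    rintro i ⟨hi, h⟩
    obtain ⟨j, rfl⟩ := Nat.exists_eq_add_of_le' hi
    rw [huniq j ((key j).1 h)]
  · obtain ⟨m, rfl⟩ := Nat.exists_eq_add_of_le' hi
    rw [hB] at h1
    rw [hC] at h2
    rw [hX]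
    exact R_eq_g h1 h2
  · obtain ⟨m, rfl⟩ := Nat.exists_eq_add_of_le' hi
    rw [hC] at h1
    rw [show m + 3 + 1 = m + 1 + 3 by ring, hB] at h2
    have e : X (m + 3 + 2) = g (2 * m + 5) := X_eq_g (m + 1)
    rw [hX, e, R_eq_g (k := 2 * m + 4) (by omega) (by
      rw [show 2 * m + 4 + 1 = 2 * (m + 1) + 3 by ring]
      omega)]
    exact g_add_five (2 * m + 5)
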